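/- Let $(\mathcal B,\mathbb E,\mathfrak s)$ be an extriangulated category in the sense of Nakaoka and Palu: $\mathcal B$ is an additive category, $\mathbb E\colon\mathcal B^{\mathrm{op}}\times\mathcal B\to\mathrm{Ab}$ is an additive bifunctor, and $\mathfrak s$ is an additive realization of $\mathbb E$ satisfying (ET3), (ET3)$^{\mathrm{op}}$, (ET4), (ET4)$^{\mathrm{op}}$. A sequence $A\to B\to C$ is a *conflation* if it realizes some $\delta\in\mathbb E(C,A)$. A *cotorsion pair* is a pair $(\mathcal U,\mathcal V)$ of full additive subcategories of $\mathcal B$, closed under isomorphisms and direct summands, such that $\mathbb E(\mathcal U,\mathcal V)=0$ and such that every object $X$ of $\mathcal B$ admits conflations $V_X\to U_X\to X$ and $X\to V^X\to U^X$ with $U_X,U^X\in\mathcal U$ and $V_X,V^X\in\mathcal V$. A *twin cotorsion pair* $((\mathcal S,\mathcal T),(\mathcal U,\mathcal V))$ is a pair of cotorsion pairs with $\mathbb E(\mathcal S,\mathcal V)=0$. Put $\mathcal W=\mathcal T\cap\mathcal U$; let $\mathcal B^+$ be the class of objects $X$ admitting a conflation $V\to W\to X$ with $V\in\mathcal V$,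 $W\in\mathcal W$, let $\mathcal B^-$ be the class of objects $X$ admitting a conflation $X\to W\to S$ with $W\in\mathcal W$, $S\in\mathcal S$, and put $\mathcal H=\mathcal B^+\cap\mathcal B^-$. The *heart* $\underline{\mathcal H}=\mathcal H/\mathcal W$ is the full subcategory, on the objects of $\mathcal H$, of the quotient $\mathcal B/\mathcal W$ of $\mathcal B$ by the ideal of morphisms factoring through an object of $\mathcal W$. **Theorem.** For any twin cotorsion pair $((\mathcal S,\mathcal T),(\mathcal U,\mathcal V))$ on an extriangulated category, the heart $\underline{\mathcal H}$ is semi-abelian. That is: 1. $\underline{\mathcal H}$ is preabelian: it is an additive category in which every morphism has a kernel and a cokernel. 2. For every pull-back square in $\underline{\mathcal H}$ $$\begin{array}{ccc}A&\xrightarrow{\ a\ }&B\\ {\scriptstyle b}\downarrow&&\downarrow{\scriptstyle c}\\ C&\xrightarrow{\ d\ }&D\end{array}$$ in which $d$ is a cokernel of some morphism, $a$ is an epimorphism. 3. For every push-out square in $\underline{\mathcal H}$ $$\begin{array}{ccc}D&\xrightarrow{\ d\ }&C\\ {\scriptstyle c}\downarrow&&\downarrow{\scriptstyle b}\\ B&\xrightarrow{\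 a\ }&A\end{array}$$ in which $d$ is a kernel of some morphism, $a$ is a monomorphism. -/

import Mathlib

open CategoryTheory CategoryTheory.Limits

universe w v u

namespace Extri

section Extensions

variable {B : Type u} [Category.{v} B]

/-- The group `𝔼(C, A)` of `𝔼`-extensions, for a bifunctor `𝔼 : Bᵒᵖ × B → Ab`. -/
abbrev Extension (E : Bᵒᵖ ⥤ B ⥤ AddCommGrpCat.{w}) (C A : B) : Type w :=
  (E.obj (Opposite.op C)).obj A

/-- `a_* δ`, for `a : A ⟶ A'` and `δ ∈ 𝔼(C, A)`. -/
def push (E : Bᵒᵖ ⥤ B ⥤ AddCommGrpCat.{w}) {C A A' : B} (a : A ⟶ A')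
    (δ : Extension E C A) : Extension E C A' :=
  ((E.obj (Opposite.op C)).map a) δ

/-- `c^* δ`, for `c : C' ⟶ C` and `δ ∈ 𝔼(C, A)`. -/
def pull (E : Bᵒᵖ ⥤ B ⥤ AddCommGrpCat.{w}) {C C' A : B} (c : C' ⟶ C)
    (δ : Extension E C A) : Extension E C' A :=
  ((E.map c.op).app A) δ

/-- A sequence of morphisms `A ⟶ mid ⟶ C`. -/
structure Seq (A C : B) where
  /-- the middle term -/
  mid : B
  /-- the first morphism -/
  fst : A ⟶ mid
  /-- the second morphism -/
  snd : mid ⟶ C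

/-- Two sequences `A ⟶ M ⟶ C` and `A ⟶ M' ⟶ C` are equivalent if there is an isomorphism
`M ≅ M'` compatible with the morphisms from `A` and to `C`. -/
def Seq.setoid (A C : B) : Setoid (Seq A C) where
  r s t := ∃ b : s.mid ≅ t.mid, s.fst ≫ b.hom = t.fst ∧ b.hom ≫ t.snd = s.snd
  iseqv :=
    { refl := fun s => ⟨Iso.refl _, by simp, by simp⟩
      symm := by
        rintro s t ⟨b, h₁, h₂⟩
        exact ⟨b.symm, by simp [← h₁], by simp [← h₂]⟩
      trans := by
        rintro s t r ⟨b, h₁, h₂⟩ ⟨b', h₁', h₂'⟩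
        exact ⟨b ≪≫ b', by simp [← h₁', ← h₁], by simp [h₂', h₂]⟩ }

/-- Equivalence classes `[A ⟶ M ⟶ C]` of sequences. -/
def SeqClass (A C : B) : Type (max u v) := _root_.Quotient (Seq.setoid A C)

/-- The equivalence class `[A --x--> M --y--> C]`. -/
def SeqClass.mk {A M C : B} (x : A ⟶ M) (y : M ⟶ C) : SeqClass A C :=
  _root_.Quotient.mk (Seq.setoid A C) ⟨M, x, y⟩

/-- The sum `δ ⊕ δ' ∈ 𝔼(C ⊞ C', A ⊞ A')` of two extensions: the element with components
`(δ, 0, 0, δ')`. -/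
noncomputable def extSum [Preadditive B] [HasBinaryBiproducts B]
    (E : Bᵒᵖ ⥤ B ⥤ AddCommGrpCat.{w}) {C A C' A' : B}
    (δ : Extension E C A) (δ' : Extension E C' A') : Extension E (C ⊞ C') (A ⊞ A') :=
  pull E biprod.fst (push E biprod.inl δ) + pull E biprod.snd (push E biprod.inr δ')

end Extensions

/-- The structure of an extriangulated category (in the sense of Nakaoka and Palu) on an additive
category `B`: an additive bifunctor `𝔼` (ET1), together with an additive realization `𝔰` (ET2),
satisfying (ET3), (ET3)ᵒᵖ, (ET4) and (ET4)ᵒᵖ. -/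
structure ExtriangulatedStructure (B : Type u) [Category.{v} B] [Preadditive B]
    [HasZeroObject B] [HasBinaryBiproducts B] where
  /-- the bifunctor `𝔼 : Bᵒᵖ × B → Ab` -/
  E : Bᵒᵖ ⥤ B ⥤ AddCommGrpCat.{w}
  additive_right : ∀ C : Bᵒᵖ, (E.obj C).Additive
  additive_left : ∀ A : B, (E.flip.obj A).Additive
  /-- the realization, assigning to `δ ∈ 𝔼(C, A)` a class `[A ⟶ M ⟶ C]` -/
  real : ∀ ⦃C A : B⦄, Extension E C A → SeqClass A C
  /-- morphisms of extensions lift to morphisms of the realizing sequences -/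
  real_lift : ∀ ⦃A M C A' M' C' : B⦄ (x : A ⟶ M) (y : M ⟶ C) (x' : A' ⟶ M') (y' : M' ⟶ C')
    (δ : Extension E C A) (δ' : Extension E C' A'),
    real δ = SeqClass.mk x y → real δ' = SeqClass.mk x' y' →
    ∀ (a : A ⟶ A') (c : C ⟶ C'), push E a δ = pull E c δ' →
      ∃ b : M ⟶ M', x ≫ b = a ≫ x' ∧ y ≫ c = b ≫ y'
  real_zero : ∀ C A : B,
    real (0 : Extension E C A) =
      SeqClass.mk (biprod.inl : A ⟶ A ⊞ C) (biprod.snd : A ⊞ C ⟶ C)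
  real_sum : ∀ ⦃A M C A' M' C' : B⦄ (x : A ⟶ M) (y : M ⟶ C) (x' : A' ⟶ M') (y' : M' ⟶ C')
    (δ : Extension E C A) (δ' : Extension E C' A'),
    real δ = SeqClass.mk x y → real δ' = SeqClass.mk x' y' →
      real (extSum E δ δ') = SeqClass.mk (biprod.map x x') (biprod.map y y')
  et3 : ∀ ⦃A M C A' M' C' : B⦄ (x : A ⟶ M) (y : M ⟶ C) (x' : A' ⟶ M') (y' : M' ⟶ C')
    (δ : Extension E C A) (δ' : Extension E C' A'),
    real δ = SeqClass.mk x y → real δ' = SeqClass.mk x' y' →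
    ∀ (a : A ⟶ A') (b : M ⟶ M'), x ≫ b = a ≫ x' →
      ∃ c : C ⟶ C', push E a δ = pull E c δ' ∧ y ≫ c = b ≫ y'
  et3_op : ∀ ⦃A M C A' M' C' : B⦄ (x : A ⟶ M) (y : M ⟶ C) (x' : A' ⟶ M') (y' : M' ⟶ C')
    (δ : Extension E C A) (δ' : Extension E C' A'),
    real δ = SeqClass.mk x y → real δ' = SeqClass.mk x' y' →
    ∀ (b : M ⟶ M') (c : C ⟶ C'), y ≫ c = b ≫ y' →
      ∃ a : A ⟶ A', push E a δ = pull E c δ' ∧ x ≫ b = a ≫ x'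
  et4 : ∀ ⦃A M D N F : B⦄ (f : A ⟶ M) (f' : M ⟶ D) (g : M ⟶ N) (g' : N ⟶ F)
    (δ : Extension E D A) (δ' : Extension E F M),
    real δ = SeqClass.mk f f' → real δ' = SeqClass.mk g g' →
    ∃ (X : B) (h : A ⟶ N) (h' : N ⟶ X) (d : D ⟶ X) (e : X ⟶ F) (δ'' : Extension E X A),
      h = f ≫ g ∧ g ≫ h' = f' ≫ d ∧ h' ≫ e = g' ∧
      real δ'' = SeqClass.mk h h' ∧
      real (push E f' δ') = SeqClass.mk d e ∧
      pull E d δ'' = δ ∧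
      push E f δ'' = pull E e δ'
  et4_op : ∀ ⦃A M D N F : B⦄ (f' : D ⟶ M) (f : M ⟶ A) (g' : F ⟶ N) (g : N ⟶ M)
    (δ : Extension E A D) (δ' : Extension E M F),
    real δ = SeqClass.mk f' f → real δ' = SeqClass.mk g' g →
    ∃ (X : B) (h' : X ⟶ N) (h : N ⟶ A) (d : X ⟶ D) (e : F ⟶ X) (δ'' : Extension E A X),
      h = g ≫ f ∧ h' ≫ g = d ≫ f' ∧ e ≫ h' = g' ∧
      real δ'' = SeqClass.mk h' h ∧
      real (pull E f' δ') = SeqClass.mk e d ∧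
      push E d δ'' = δ ∧
      pull E f δ'' = push E e δ'

section Subcategories

variable {B : Type u} [Category.{v} B] [Preadditive B] [HasZeroObject B] [HasBinaryBiproducts B]

/-- A (strictly) full additive subcategory, closed under isomorphisms. -/
structure IsAdditiveSubcategory (P : ObjectProperty B) : Prop where
  zero : ∀ ⦃Z : B⦄, IsZero Z → P Z
  iso : ∀ ⦃X Y : B⦄, (X ≅ Y) → P X → P Y
  biprod : ∀ ⦃X Y : B⦄, P X → P Y → P (X ⊞ Y)

/-- Closure under direct summands. -/
def ClosedUnderSummands (P : ObjectProperty B) : Prop :=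
  ∀ ⦃X Y : B⦄, P (X ⊞ Y) → P X ∧ P Y

/-- The ideal of morphisms factoring through an object of `P`, as a relation on parallel
morphisms: `f` and `g` are related if `f - g` factors through an object satisfying `P`. -/
def idealRel (P : ObjectProperty B) : HomRel B := fun X Y f g =>
  ∃ (Z : B) (i : X ⟶ Z) (p : Z ⟶ Y), P Z ∧ i ≫ p = f - g

lemma idealRel_add {P : ObjectProperty B} (hP : IsAdditiveSubcategory P) ⦃X Y : B⦄
    (f₁ f₂ g₁ g₂ : X ⟶ Y) (h : idealRel P f₁ f₂) (h' : idealRel P g₁ g₂) :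
    idealRel P (f₁ + g₁) (f₂ + g₂) := by
  obtain ⟨Z, i, p, hZ, e⟩ := h
  obtain ⟨Z', i', p', hZ', e'⟩ := h'
  refine ⟨Z ⊞ Z', biprod.lift i i', biprod.desc p p', hP.biprod hZ hZ', ?_⟩
  rw [biprod.lift_desc, e, e']
  abel

lemma idealRel_congruence {P : ObjectProperty B} (hP : IsAdditiveSubcategory P) :
    Congruence (idealRel P) where
  equivalence :=
    { refl := fun f => by
        obtain ⟨Z, hZ⟩ := HasZeroObject.zero (C := B)
        exact ⟨Z, 0, 0, hP.zero hZ, by simp⟩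
      symm := by
        rintro f g ⟨Z, i, p, hZ, e⟩
        exact ⟨Z, -i, p, hZ, by simp [e]⟩
      trans := by
        rintro f g h ⟨Z, i, p, hZ, e⟩ ⟨Z', i', p', hZ', e'⟩
        refine ⟨Z ⊞ Z', biprod.lift i i', biprod.desc p p', hP.biprod hZ hZ', ?_⟩
        rw [biprod.lift_desc, e, e']
        abel }
  comp_left := by
    rintro X Y Z f g g' ⟨W, i, p, hW, e⟩
    exact ⟨W, f ≫ i, p, hW, by simp [e]⟩
  comp_right := by
    rintro X Y Z f f' g ⟨W, i, p, hW, e⟩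
    exact ⟨W, i, p ≫ g, hW, by rw [← Category.assoc, e, Preadditive.sub_comp]⟩

/-- The quotient category `B/P`: the objects are those of `B`, and the morphisms are those of `B`
modulo the morphisms factoring through an object of `P`. -/
abbrev IdealQuotient (P : ObjectProperty B) : Type u := CategoryTheory.Quotient (idealRel P)

/-- The preadditive structure on `B/P` induced from that of `B`. -/
@[reducible]
noncomputable def idealQuotientPreadditive {P : ObjectProperty B} (hP : IsAdditiveSubcategory P) :
    Preadditive (IdealQuotient P) :=
  haveI := idealRel_congruence hP
  CategoryTheory.Quotient.preadditive (idealRel P) (idealRel_add hP)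

end Subcategories

namespace ExtriangulatedStructure

variable {B : Type u} [Category.{v} B] [Preadditive B] [HasZeroObject B] [HasBinaryBiproducts B]

/-- `A --x--> M --y--> C` is a conflation: it realizes some extension. -/
def IsConflation (𝓔 : ExtriangulatedStructure.{w} B) {A M C : B} (x : A ⟶ M) (y : M ⟶ C) : Prop :=
  ∃ δ : Extension 𝓔.E C A, 𝓔.real δ = SeqClass.mk x y

/-- `𝔼(P, Q) = 0` for subcategories `P` and `Q`. -/
def ExtVanish (𝓔 : ExtriangulatedStructure.{w} B) (P Q : ObjectProperty B) : Prop :=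
  ∀ ⦃C A : B⦄, P C → Q A → ∀ δ : Extension 𝓔.E C A, δ = 0

/-- `Cone(P, Q)`: the objects `X` admitting a conflation `P' ⟶ Q' ⟶ X`. -/
def cone (𝓔 : ExtriangulatedStructure.{w} B) (P Q : ObjectProperty B) : ObjectProperty B :=
  fun X => ∃ (P' Q' : B) (x : P' ⟶ Q') (y : Q' ⟶ X), P P' ∧ Q Q' ∧ 𝓔.IsConflation x y

/-- `CoCone(P, Q)`: the objects `X` admitting a conflation `X ⟶ P' ⟶ Q'`. -/
def cocone (𝓔 : ExtriangulatedStructure.{w} B) (P Q : ObjectProperty B) : ObjectProperty B :=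
  fun X => ∃ (P' Q' : B) (x : X ⟶ P') (y : P' ⟶ Q'), P P' ∧ Q Q' ∧ 𝓔.IsConflation x y

/-- A (complete) cotorsion pair `(U, V)`. -/
structure IsCotorsionPair (𝓔 : ExtriangulatedStructure.{w} B) (U V : ObjectProperty B) :
    Prop where
  additive_left : IsAdditiveSubcategory U
  summands_left : ClosedUnderSummands U
  additive_right : IsAdditiveSubcategory V
  summands_right : ClosedUnderSummands V
  ext_vanish : 𝓔.ExtVanish U V
  /-- every `X` admits a conflation `V_X ⟶ U_X ⟶ X` -/
  resolution : ∀ X : B, 𝓔.cone V U X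
  /-- every `X` admits a conflation `X ⟶ V^X ⟶ U^X` -/
  coresolution : ∀ X : B, 𝓔.cocone V U X

/-- A twin cotorsion pair `((S, T), (U, V))`. -/
structure TwinCotorsionPair (𝓔 : ExtriangulatedStructure.{w} B) where
  /-- the class `S` -/
  S : ObjectProperty B
  /-- the class `T` -/
  T : ObjectProperty B
  /-- the class `U` -/
  U : ObjectProperty B
  /-- the class `V` -/
  V : ObjectProperty B
  cotorsion_ST : 𝓔.IsCotorsionPair S T
  cotorsion_UV : 𝓔.IsCotorsionPair U V
  ext_vanish : 𝓔.ExtVanish S V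

namespace TwinCotorsionPair

variable {𝓔 : ExtriangulatedStructure.{w} B}

/-- The core `W = T ∩ U`. -/
def W (τ : 𝓔.TwinCotorsionPair) : ObjectProperty B := fun X => τ.T X ∧ τ.U X

lemma isAdditiveSubcategory_W (τ : 𝓔.TwinCotorsionPair) : IsAdditiveSubcategory τ.W where
  zero := fun _ h =>
    ⟨τ.cotorsion_ST.additive_right.zero h, τ.cotorsion_UV.additive_left.zero h⟩
  iso := fun _ _ e h =>
    ⟨τ.cotorsion_ST.additive_right.iso e h.1, τ.cotorsion_UV.additive_left.iso e h.2⟩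
  biprod := fun _ _ h h' =>
    ⟨τ.cotorsion_ST.additive_right.biprod h.1 h'.1, τ.cotorsion_UV.additive_left.biprod h.2 h'.2⟩

/-- `B⁺ = Cone(V, W)`. -/
def plus (τ : 𝓔.TwinCotorsionPair) : ObjectProperty B := 𝓔.cone τ.V τ.W

/-- `B⁻ = CoCone(W, S)`. -/
def minus (τ : 𝓔.TwinCotorsionPair) : ObjectProperty B := 𝓔.cocone τ.W τ.S

/-- `H = B⁺ ∩ B⁻`, as a class of objects of `B`. -/
def heartObj (τ : 𝓔.TwinCotorsionPair) : ObjectProperty B := fun X => τ.plus X ∧ τ.minus X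

/-- `H`, as a class of objects of the quotient category `B/W` (whose objects are those of `B`). -/
def heartProperty (τ : 𝓔.TwinCotorsionPair) : ObjectProperty (IdealQuotient τ.W) :=
  fun X => τ.heartObj X.as

/-- The heart `H/W`, as the full subcategory of `B/W` on the objects of `H`. -/
abbrev Heart (τ : 𝓔.TwinCotorsionPair) : Type u := τ.heartProperty.FullSubcategory

/-- The addition of morphisms in the heart is induced from that of `B`. -/
noncomputable instance (τ : 𝓔.TwinCotorsionPair) : Preadditive τ.Heart :=
  letI := idealQuotientPreadditive τ.isAdditiveSubcategory_W
  inferInstance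

end TwinCotorsionPair

end ExtriangulatedStructure

/-- A preabelian category: an additive category in which every morphism has a kernel and a
cokernel. -/
structure IsPreabelian (A : Type u) [Category.{v} A] [Preadditive A] : Prop where
  hasZeroObject : HasZeroObject A
  hasBinaryBiproducts : HasBinaryBiproducts A
  hasKernels : HasKernels A
  hasCokernels : HasCokernels A

/-- A semi-abelian category: a preabelian category such that, in a pull-back square, the morphism
parallel to a cokernel is an epimorphism and, in a push-out square, the morphism parallel to a
kernel is a monomorphism. (`NormalEpi d` means that `d` is a cokernel of some morphism, and
`NormalMono d` that `d` is a kernel of some morphism.) -/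
structure IsSemiabelian (A : Type u) [Category.{v} A] [Preadditive A] : Prop
    extends IsPreabelian A where
  left : ∀ ⦃X Y Z D : A⦄ (a : X ⟶ Y) (b : X ⟶ Z) (c : Y ⟶ D) (d : Z ⟶ D),
    IsPullback a b c d → Nonempty (NormalEpi d) → Epi a
  right : ∀ ⦃X Y Z D : A⦄ (a : Y ⟶ X) (b : Z ⟶ X) (c : D ⟶ Y) (d : D ⟶ Z),
    IsPushout c d a b → Nonempty (NormalMono d) → Mono a

end Extri

/-!
Write `ℋ` for the objects of the heart, and call a morphism of `B` zero modulo `𝒲` if it factors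
through an object of `𝒲`. The heart being the quotient of `ℋ` by the morphisms that are zero modulo
`𝒲`, everything is a statement about morphisms of `B`, and half of it suffices: the opposite of an
extriangulated category is extriangulated (`ExtriangulatedStructure.op`), and `((𝒱, 𝒰), (𝒯, 𝒮))` is
a twin cotorsion pair on it, with the same `𝒲` and `ℋ` (`TwinCotorsionPair.op`).

Two facts carry the argument. First, if `X ⟶ Z ⟶ S` is a conflation with `S ∈ 𝒮`, then `X ⟶ Z` is
an epimorphism modulo `𝒲` as far as morphisms to objects of `B⁺` are concerned
(`factorsThrough_of_comp`), and `X ∈ B⁻` if and only if `Z ∈ B⁻` (`minus_of_isConflation_left`,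
`minus_of_isConflation_middle`). Second, every object `C` has such an inflation `C ⟶ D` with
`D ∈ B⁺` along which all morphisms to objects of `B⁺` extend (`exists_plus_approximation`); if
`C ∈ B⁻`, then `D ∈ ℋ`.

The cokernel of `f : A ⟶ Z` is obtained from a conflation `A ⟶ W ⟶ S` by pushing it out along `f`
to a conflation `Z ⟶ C₀ ⟶ S` and approximating `C₀` by an object `C` of `B⁺`. The composite
`Z ⟶ C` is again an inflation with cokernel `S'` in `𝒮`. Since every cokernel in the heart is
isomorphic to one of this kind, consider a morphism `b : D ⟶ C`. After adding to `D` an object of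
`𝒲`, the composite `D ⟶ C ⟶ S'` is a deflation, with kernel `K ⟶ D`, and `K ⟶ D ⟶ C` lifts to `Z`.
By the first fact `K ∈ B⁻` and `K ⟶ D` is an epimorphism modulo `𝒲`; by the second, `K` can be
replaced by an object `X` of `ℋ`. This gives a commutative square over `b` and `Z ⟶ C` whose side
`X ⟶ D` is an epimorphism (`exists_cokernel`). If `P` is the pull-back in the heart, then `X ⟶ D`
factors through `P ⟶ D`, which is therefore an epimorphism (`isSemiabelian_of_exists`).
-/

namespace Extri

/-! ### Extensions and their realizations -/

section Extensions

variable {B : Type u} [Category.{v} B] (E : Bᵒᵖ ⥤ B ⥤ AddCommGrpCat.{w})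

lemma push_id {C A : B} (δ : Extension E C A) : push E (𝟙 A) δ = δ := by
  simp [push]

lemma pull_id {C A : B} (δ : Extension E C A) : pull E (𝟙 C) δ = δ := by
  simp [pull]

lemma push_comp {C A A' A'' : B} (a : A ⟶ A') (a' : A' ⟶ A'') (δ : Extension E C A) :
    push E (a ≫ a') δ = push E a' (push E a δ) := by
  simp [push]

lemma pull_comp {C C' C'' A : B} (c' : C'' ⟶ C') (c : C' ⟶ C) (δ : Extension E C A) :
    pull E (c' ≫ c) δ = pull E c' (pull E c δ) := by
  simp [pull]

lemma push_pull {C C' A A' : B} (a : A ⟶ A') (c : C' ⟶ C) (δ : Extension E C A) :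
    push E a (pull E c δ) = pull E c (push E a δ) :=
  congr($((E.map c.op).naturality a) δ).symm

lemma push_zero_ext {C A A' : B} (a : A ⟶ A') : push E a (0 : Extension E C A) = 0 :=
  map_zero _

lemma pull_zero_ext {C C' A : B} (c : C' ⟶ C) : pull E c (0 : Extension E C A) = 0 :=
  map_zero _

lemma push_add_ext {C A A' : B} (a : A ⟶ A') (δ δ' : Extension E C A) :
    push E a (δ + δ') = push E a δ + push E a δ' :=
  map_add _ _ _

lemma pull_add_ext {C C' A : B} (c : C' ⟶ C) (δ δ' : Extension E C A) :
    pull E c (δ + δ') = pull E c δ + pull E c δ' :=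
  map_add _ _ _

lemma SeqClass.mk_eq_mk_iff {A C M M' : B} (x : A ⟶ M) (y : M ⟶ C) (x' : A ⟶ M') (y' : M' ⟶ C) :
    SeqClass.mk x y = SeqClass.mk x' y' ↔
      ∃ b : M ≅ M', x ≫ b.hom = x' ∧ b.hom ≫ y' = y :=
  _root_.Quotient.eq (r := Seq.setoid A C)

end Extensions

namespace ExtriangulatedStructure

variable {B : Type u} [Category.{v} B] [Preadditive B] [HasZeroObject B] [HasBinaryBiproducts B]
  (𝓔 : ExtriangulatedStructure.{w} B)

lemma push_zero {C A A' : B} (δ : Extension 𝓔.E C A) : push 𝓔.E (0 : A ⟶ A') δ = 0 := by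
  have := 𝓔.additive_right (Opposite.op C)
  simp [push]

lemma push_add {C A A' : B} (a a' : A ⟶ A') (δ : Extension 𝓔.E C A) :
    push 𝓔.E (a + a') δ = push 𝓔.E a δ + push 𝓔.E a' δ := by
  have := 𝓔.additive_right (Opposite.op C)
  simp [push, Functor.map_add]

lemma pull_zero {C C' A : B} (δ : Extension 𝓔.E C A) : pull 𝓔.E (0 : C' ⟶ C) δ = 0 := by
  have := 𝓔.additive_left A
  have : (𝓔.E.flip.obj A).map (0 : C' ⟶ C).op = 0 := by
    rw [op_zero, Functor.map_zero]
  exact congr($(this) δ)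

lemma pull_add {C C' A : B} (c c' : C' ⟶ C) (δ : Extension 𝓔.E C A) :
    pull 𝓔.E (c + c') δ = pull 𝓔.E c δ + pull 𝓔.E c' δ := by
  have := 𝓔.additive_left A
  have : (𝓔.E.flip.obj A).map (c + c').op =
      (𝓔.E.flip.obj A).map c.op + (𝓔.E.flip.obj A).map c'.op := by
    rw [op_add, Functor.map_add]
  exact congr($(this) δ)

lemma exists_real {C A : B} (δ : Extension 𝓔.E C A) :
    ∃ (M : B) (x : A ⟶ M) (y : M ⟶ C), 𝓔.real δ = SeqClass.mk x y := by
  obtain ⟨⟨M, x, y⟩, h⟩ := _root_.Quotient.exists_rep (𝓔.real δ)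
  exact ⟨M, x, y, h.symm⟩

open scoped ZeroObject

/-! ### Exactness -/

section Exactness

variable {𝓔} {A M C : B} {x : A ⟶ M} {y : M ⟶ C} {δ : Extension 𝓔.E C A}

lemma comp_eq_zero (h : 𝓔.real δ = SeqClass.mk x y) : x ≫ y = 0 := by
  obtain ⟨b, hb, hb'⟩ := 𝓔.real_lift _ _ _ _ _ _ h (𝓔.real_zero C (0 : B)) 0 (𝟙 C)
    (by rw [push_zero, pull_zero_ext])
  rw [Category.comp_id] at hb'
  rw [hb', reassoc_of% hb, zero_comp]

lemma exists_factor_snd (h : 𝓔.real δ = SeqClass.mk x y) {Y : B} (g : M ⟶ Y) (hg : x ≫ g = 0) :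
    ∃ k : C ⟶ Y, y ≫ k = g := by
  obtain ⟨c, -, hc⟩ := 𝓔.et3 _ _ _ _ _ _ h (𝓔.real_zero Y (0 : B)) 0 (biprod.lift 0 g)
    (by ext ; simp [hg])
  exact ⟨c, by simpa using hc⟩

lemma exists_factor_fst (h : 𝓔.real δ = SeqClass.mk x y) {Y : B} (g : Y ⟶ M) (hg : g ≫ y = 0) :
    ∃ k : Y ⟶ A, k ≫ x = g := by
  obtain ⟨a, -, ha⟩ := 𝓔.et3_op _ _ _ _ _ _ (𝓔.real_zero (0 : B) Y) h (biprod.desc g 0) 0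
    (by ext ; simp [hg])
  exact ⟨a, by simpa using ha.symm⟩

/-- The class `g_* δ` is the obstruction to extending `g` along `x`. -/
lemma exists_extension (h : 𝓔.real δ = SeqClass.mk x y) {Y : B} (g : A ⟶ Y)
    (hg : push 𝓔.E g δ = 0) : ∃ k : M ⟶ Y, x ≫ k = g := by
  obtain ⟨b, hb, -⟩ := 𝓔.real_lift _ _ _ _ _ _ h (𝓔.real_zero (0 : B) Y) g 0
    (by rw [hg, pull_zero_ext])
  exact ⟨b ≫ biprod.fst, by rw [reassoc_of% hb]; simp⟩

/-- The class `g^* δ` is the obstruction to lifting `g` along `y`. -/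
lemma exists_lift (h : 𝓔.real δ = SeqClass.mk x y) {Y : B} (g : Y ⟶ C)
    (hg : pull 𝓔.E g δ = 0) : ∃ k : Y ⟶ M, k ≫ y = g := by
  obtain ⟨b, -, hb⟩ := 𝓔.real_lift _ _ _ _ _ _ (𝓔.real_zero Y (0 : B)) h 0 g
    (by rw [hg, push_zero_ext])
  exact ⟨biprod.inr ≫ b, by rw [Category.assoc, ← hb]; simp⟩

/-- Exactness of `𝔼(C, Q) ⟶ 𝔼(M, Q) ⟶ 𝔼(A, Q)` at the middle term, when `𝔼(C, Q) = 0`: the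
class `ε` is pulled back along `y` from a class over `C`, by (ET4)ᵒᵖ. -/
lemma eq_zero_of_pull_fst_eq_zero (h : 𝓔.real δ = SeqClass.mk x y) {Q : B}
    (hC : ∀ ε : Extension 𝓔.E C Q, ε = 0) (ε : Extension 𝓔.E M Q) (hε : pull 𝓔.E x ε = 0) :
    ε = 0 := by
  obtain ⟨N, g', g, hg⟩ := 𝓔.exists_real ε
  obtain ⟨X, h', -, d, e, δ'', -, -, -, -, hed, -, hpull⟩ := 𝓔.et4_op _ _ _ _ _ _ h hg
  obtain ⟨r, hr⟩ := exists_extension hed (𝟙 Q) (by rw [hε, push_zero_ext])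
  calc ε = push 𝓔.E (e ≫ r) ε := by rw [hr, push_id]
    _ = pull 𝓔.E y (push 𝓔.E r δ'') := by rw [push_comp, ← hpull, push_pull]
    _ = 0 := by rw [hC (push 𝓔.E r δ''), pull_zero_ext]

/-- A sequence obtained from a realization of `δ` by isomorphisms of the end terms realizes the
corresponding extension. Two comparison morphisms given by the realization compose to an
endomorphism `1 + n` with `n ^ 2 = 0`, so they are isomorphisms. -/
lemma real_eq_of_iso (h : 𝓔.real δ = SeqClass.mk x y) {A' C' : B} (a : A ≅ A') (c : C ≅ C')
    {δ' : Extension 𝓔.E C' A'} (hδ : push 𝓔.E a.hom δ = pull 𝓔.E c.hom δ') :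
    𝓔.real δ' = SeqClass.mk (a.inv ≫ x) (y ≫ c.hom) := by
  have key : ∀ {A M C : B} {x : A ⟶ M} {y : M ⟶ C} {δ : Extension 𝓔.E C A}
      (_ : 𝓔.real δ = SeqClass.mk x y) (b : M ⟶ M), x ≫ b = x → b ≫ y = y → IsIso b := by
    intro A M C x y δ h b hx hy
    obtain ⟨m, hm⟩ := exists_factor_fst h (b - 𝟙 M) (by simp [hy])
    have hn : (b - 𝟙 M) ≫ (b - 𝟙 M) = 0 := by
      conv_lhs => lhs; rw [← hm]
      simp [hx]
    have hb : b ≫ b = b + b - 𝟙 M := by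
      have : b ≫ b - (b + b - 𝟙 M) = 0 := by
        rw [← hn]; simp; abel
      rwa [sub_eq_zero] at this
    exact ⟨𝟙 M + 𝟙 M - b, by simp [hb], by simp [hb]⟩
  obtain ⟨M', x', y', h'⟩ := 𝓔.exists_real δ'
  have hδ' : push 𝓔.E a.inv δ' = pull 𝓔.E c.inv δ := by
    have h₁ : δ' = pull 𝓔.E c.inv (push 𝓔.E a.hom δ) := by
      rw [hδ, ← pull_comp, c.inv_hom_id, pull_id]
    rw [h₁, push_pull, ← push_comp, a.hom_inv_id, push_id]
  obtain ⟨b, hb, hb'⟩ := 𝓔.real_lift _ _ _ _ _ _ h h' a.hom c.hom hδ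
  obtain ⟨b', hb₁, hb₁'⟩ := 𝓔.real_lift _ _ _ _ _ _ h' h a.inv c.inv hδ'
  have h₁ : IsIso (b ≫ b') := key h _ (by rw [reassoc_of% hb, hb₁]; simp)
    (by rw [Category.assoc, ← hb₁', ← reassoc_of% hb']; simp)
  have h₂ : IsIso (b' ≫ b) := key h' _ (by rw [reassoc_of% hb₁, hb]; simp)
    (by rw [Category.assoc, ← hb', ← reassoc_of% hb₁']; simp)
  have : IsSplitMono b := ⟨⟨b' ≫ inv (b ≫ b'), by rw [← Category.assoc, IsIso.hom_inv_id]⟩⟩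
  have : Epi b := epi_of_epi b' b
  have : IsIso b := isIso_of_epi_of_isSplitMono b
  rw [h', eq_comm, SeqClass.mk_eq_mk_iff]
  exact ⟨asIso b, by simp [hb], by simp [hb']⟩

end Exactness

/-- If `p` is a deflation, then so is `(c, p)`, for every morphism `c` with the same target. -/
lemma isConflation_biprod_desc {L N S : B} {l : L ⟶ N} {p : N ⟶ S} (h : 𝓔.IsConflation l p)
    {X : B} (c : X ⟶ S) :
    ∃ (K : B) (k : K ⟶ X ⊞ N), 𝓔.IsConflation k (biprod.desc c p) := by
  obtain ⟨σ, hσ⟩ := h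
  -- `(c, p)` is the composite of the deflation `1 ⊕ p` and the split deflation `(c, 1)`.
  have h₁ : 𝓔.real (0 : Extension 𝓔.E X 0) = SeqClass.mk (0 : (0 : B) ⟶ X) (𝟙 X) := by
    rw [𝓔.real_zero, SeqClass.mk_eq_mk_iff]
    exact ⟨⟨biprod.snd, biprod.inr, by ext; simp, by simp⟩, by simp, by simp⟩
  have h₂ : 𝓔.real (0 : Extension 𝓔.E S X) =
      SeqClass.mk (biprod.lift (𝟙 X) (-c)) (biprod.desc c (𝟙 S)) := by
    rw [𝓔.real_zero, SeqClass.mk_eq_mk_iff]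
    refine ⟨⟨biprod.desc (biprod.lift (𝟙 X) (-c)) biprod.inr,
      biprod.desc (biprod.lift (𝟙 X) c) biprod.inr, ?_, ?_⟩, ?_, ?_⟩ <;> ext <;> simp
  obtain ⟨K, k, f, -, -, δ, hf, -, -, hk, -⟩ :=
    𝓔.et4_op _ _ _ _ _ _ h₂ (𝓔.real_sum _ _ _ _ _ _ h₁ hσ)
  have : f = biprod.desc c p := by
    rw [hf]; ext <;> simp
  subst this
  exact ⟨K, k, δ, hk⟩

end ExtriangulatedStructure

/-! ### The opposite extriangulated category -/

/-- The sequence `A ⟶ M ⟶ C` read in the opposite category. -/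
def Seq.op {B : Type u} [Category.{v} B] {A C : B} (s : Seq A C) :
    Seq (Opposite.op C) (Opposite.op A) :=
  ⟨Opposite.op s.mid, s.snd.op, s.fst.op⟩

/-- The class of `A ⟶ M ⟶ C` read in the opposite category. -/
def SeqClass.op {B : Type u} [Category.{v} B] {A C : B} (s : SeqClass A C) :
    SeqClass (Opposite.op C) (Opposite.op A) :=
  _root_.Quotient.map' (s₁ := Seq.setoid A C) (s₂ := Seq.setoid (Opposite.op C) (Opposite.op A))
    Seq.op (by
      rintro s t ⟨b, h₁, h₂⟩
      refine ⟨b.symm.op, ?_, ?_⟩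
      · exact Quiver.Hom.unop_inj (by simp [Seq.op, ← h₂])
      · exact Quiver.Hom.unop_inj (by simp [Seq.op, ← h₁])) s

lemma SeqClass.op_eq_mk_iff {B : Type u} [Category.{v} B] {A C : B} (s : SeqClass A C) {M : Bᵒᵖ}
    (x : Opposite.op C ⟶ M) (y : M ⟶ Opposite.op A) :
    s.op = SeqClass.mk x y ↔ s = SeqClass.mk y.unop x.unop := by
  constructor
  · obtain ⟨⟨M', x', y'⟩, rfl⟩ := _root_.Quotient.exists_rep s
    intro h
    obtain ⟨b, h₁, h₂⟩ := (SeqClass.mk_eq_mk_iff y'.op x'.op x y).1 h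
    refine (SeqClass.mk_eq_mk_iff x' y' y.unop x.unop).2 ⟨b.symm.unop, ?_, ?_⟩
    · exact Quiver.Hom.op_inj (by simp [← h₂])
    · exact Quiver.Hom.op_inj (by simp [← h₁])
  · rintro rfl
    rfl

section OppositeBiproducts

variable {B : Type u} [Category.{v} B] [Preadditive B] [HasBinaryBiproducts B]

/-- The biproduct of the opposite category is that of the original one. -/
noncomputable def opBiprodIso (X Y : Bᵒᵖ) : (X ⊞ Y).unop ≅ X.unop ⊞ Y.unop where
  hom := biprod.lift (biprod.inl : X ⟶ X ⊞ Y).unop (biprod.inr : Y ⟶ X ⊞ Y).unop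
  inv := biprod.desc (biprod.fst : X ⊞ Y ⟶ X).unop (biprod.snd : X ⊞ Y ⟶ Y).unop
  hom_inv_id := by
    rw [biprod.lift_desc, ← unop_comp, ← unop_comp, ← unop_add, biprod.total, unop_id]
  inv_hom_id := by
    ext <;> simp [← unop_comp]

@[simp]
lemma inl_opBiprodIso_inv (X Y : Bᵒᵖ) :
    biprod.inl ≫ (opBiprodIso X Y).inv = (biprod.fst : X ⊞ Y ⟶ X).unop := by
  simp [opBiprodIso]

@[simp]
lemma inr_opBiprodIso_inv (X Y : Bᵒᵖ) :
    biprod.inr ≫ (opBiprodIso X Y).inv = (biprod.snd : X ⊞ Y ⟶ Y).unop := by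
  simp [opBiprodIso]

@[simp]
lemma opBiprodIso_inv_inl_unop (X Y : Bᵒᵖ) :
    (opBiprodIso X Y).inv ≫ (biprod.inl : X ⟶ X ⊞ Y).unop = biprod.fst := by
  rw [Iso.inv_comp_eq]
  simp [opBiprodIso]

@[simp]
lemma opBiprodIso_inv_inr_unop (X Y : Bᵒᵖ) :
    (opBiprodIso X Y).inv ≫ (biprod.inr : Y ⟶ X ⊞ Y).unop = biprod.snd := by
  rw [Iso.inv_comp_eq]
  simp [opBiprodIso]

end OppositeBiproducts

namespace ExtriangulatedStructure

variable {B : Type u} [Category.{v} B] [Preadditive B] [HasZeroObject B] [HasBinaryBiproducts B]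
  (𝓔 : ExtriangulatedStructure.{w} B)

/-- The bifunctor `(C, A) ↦ 𝔼(A, C)` on the opposite category. -/
abbrev opExtension : Bᵒᵖᵒᵖ ⥤ Bᵒᵖ ⥤ AddCommGrpCat.{w} :=
  unopUnop B ⋙ 𝓔.E.flip

/-- The opposite of an extriangulated category is extriangulated, by `𝔼ᵒᵖ(C, A) = 𝔼(A, C)`. -/
noncomputable def op : ExtriangulatedStructure.{w} Bᵒᵖ where
  E := 𝓔.opExtension
  additive_right C := ⟨fun {A A'} a a' => by
    ext δ
    exact 𝓔.pull_add a.unop a'.unop δ⟩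
  additive_left A := ⟨fun {C C'} c c' => by
    ext δ
    exact 𝓔.push_add c.unop.unop c'.unop.unop δ⟩
  real C A δ := (𝓔.real (C := A.unop) (A := C.unop) δ).op
  real_lift A M C A' M' C' x y x' y' δ δ' h h' a c e := by
    obtain ⟨b, h₁, h₂⟩ := 𝓔.real_lift _ _ _ _ _ _ ((SeqClass.op_eq_mk_iff _ _ _).1 h')
      ((SeqClass.op_eq_mk_iff _ _ _).1 h) c.unop a.unop e.symm
    exact ⟨b.op, Quiver.Hom.unop_inj h₂.symm, Quiver.Hom.unop_inj h₁.symm⟩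
  real_zero C A := by
    refine (SeqClass.op_eq_mk_iff _ _ _).2 ((𝓔.real_zero A.unop C.unop).trans ?_)
    rw [SeqClass.mk_eq_mk_iff]
    refine ⟨biprod.braiding _ _ ≪≫ (opBiprodIso A C).symm, ?_, ?_⟩
    · have : biprod.inl ≫ (biprod.braiding C.unop A.unop).hom = biprod.inr := by ext <;> simp
      rw [Iso.trans_hom, reassoc_of% this, Iso.symm_hom, inr_opBiprodIso_inv]
    · rw [Iso.trans_hom, Category.assoc, Iso.symm_hom, opBiprodIso_inv_inl_unop]
      simp
  real_sum A M C A' M' C' x y x' y' δ δ' h h' := by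
    refine (SeqClass.op_eq_mk_iff _ _ _).2 ?_
    -- `extSum` is formed with the biproducts of `Bᵒᵖ`, which are those of `B` up to isomorphism.
    have := real_eq_of_iso (𝓔.real_sum _ _ _ _ _ _ ((SeqClass.op_eq_mk_iff _ _ _).1 h)
      ((SeqClass.op_eq_mk_iff _ _ _).1 h')) (opBiprodIso C C').symm (opBiprodIso A A').symm
      (δ' := extSum 𝓔.opExtension δ δ') ?_
    · refine this.trans ((SeqClass.mk_eq_mk_iff _ _ _ _).2 ⟨(opBiprodIso M M').symm, ?_, ?_⟩)
      · rw [Iso.symm_inv, Iso.symm_hom, Category.assoc, ← Iso.eq_inv_comp]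
        ext
        · rw [biprod.inl_map_assoc, inl_opBiprodIso_inv, reassoc_of% inl_opBiprodIso_inv]
          simp [← unop_comp]
        · rw [biprod.inr_map_assoc, inr_opBiprodIso_inv, reassoc_of% inr_opBiprodIso_inv]
          simp [← unop_comp]
      · rw [Iso.symm_hom, Iso.symm_hom]
        ext
        · rw [biprod.inl_map_assoc, inl_opBiprodIso_inv, reassoc_of% inl_opBiprodIso_inv]
          simp [← unop_comp]
        · rw [biprod.inr_map_assoc, inr_opBiprodIso_inv, reassoc_of% inr_opBiprodIso_inv]
          simp [← unop_comp]
    · have e : extSum 𝓔.opExtension δ δ' =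
          push 𝓔.E (biprod.fst : C ⊞ C' ⟶ C).unop
            (pull 𝓔.E (biprod.inl : A ⟶ A ⊞ A').unop δ) +
          push 𝓔.E (biprod.snd : C ⊞ C' ⟶ C').unop
            (pull 𝓔.E (biprod.inr : A' ⟶ A ⊞ A').unop δ') := rfl
      rw [e, extSum, push_add_ext, pull_add_ext]
      simp only [Iso.symm_hom, push_pull, ← push_comp, ← pull_comp]
      simp
  et3 A M C A' M' C' x y x' y' δ δ' h h' a b e := by
    obtain ⟨c, h₁, h₂⟩ := 𝓔.et3_op _ _ _ _ _ _ ((SeqClass.op_eq_mk_iff _ _ _).1 h')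
      ((SeqClass.op_eq_mk_iff _ _ _).1 h) b.unop a.unop (Quiver.Hom.op_inj e.symm)
    exact ⟨c.op, h₁.symm, Quiver.Hom.unop_inj h₂.symm⟩
  et3_op A M C A' M' C' x y x' y' δ δ' h h' b c e := by
    obtain ⟨a, h₁, h₂⟩ := 𝓔.et3 _ _ _ _ _ _ ((SeqClass.op_eq_mk_iff _ _ _).1 h')
      ((SeqClass.op_eq_mk_iff _ _ _).1 h) c.unop b.unop (Quiver.Hom.op_inj e.symm)
    exact ⟨a.op, h₁.symm, Quiver.Hom.unop_inj h₂.symm⟩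
  et4 A M D N F f f' g g' δ δ' h h' := by
    obtain ⟨X, p, q, d, e, δ'', h₁, h₂, h₃, h₄, h₅, h₆, h₇⟩ := 𝓔.et4_op _ _ _ _ _ _
      ((SeqClass.op_eq_mk_iff _ _ _).1 h) ((SeqClass.op_eq_mk_iff _ _ _).1 h')
    exact ⟨Opposite.op X, q.op, p.op, d.op, e.op, δ'', Quiver.Hom.unop_inj h₁,
      Quiver.Hom.unop_inj h₂, Quiver.Hom.unop_inj h₃, (SeqClass.op_eq_mk_iff _ _ _).2 h₄,
      (SeqClass.op_eq_mk_iff _ _ _).2 h₅, h₆, h₇⟩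
  et4_op A M D N F f' f g' g δ δ' h h' := by
    obtain ⟨X, p, q, d, e, δ'', h₁, h₂, h₃, h₄, h₅, h₆, h₇⟩ := 𝓔.et4 _ _ _ _ _ _
      ((SeqClass.op_eq_mk_iff _ _ _).1 h) ((SeqClass.op_eq_mk_iff _ _ _).1 h')
    exact ⟨Opposite.op X, q.op, p.op, d.op, e.op, δ'', Quiver.Hom.unop_inj h₁,
      Quiver.Hom.unop_inj h₂, Quiver.Hom.unop_inj h₃, (SeqClass.op_eq_mk_iff _ _ _).2 h₄,
      (SeqClass.op_eq_mk_iff _ _ _).2 h₅, h₆, h₇⟩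

end ExtriangulatedStructure

/-! ### Duality for twin cotorsion pairs -/

section Subcategories

variable {B : Type u} [Category.{v} B]

/-- The morphism `f` factors through an object satisfying `P`. -/
def FactorsThrough (P : ObjectProperty B) {X Y : B} (f : X ⟶ Y) : Prop :=
  ∃ (Z : B) (i : X ⟶ Z) (p : Z ⟶ Y), P Z ∧ i ≫ p = f

lemma FactorsThrough.op {P : ObjectProperty B} {X Y : B} {f : X ⟶ Y} (h : FactorsThrough P f) :
    FactorsThrough P.op f.op := by
  obtain ⟨Z, i, p, hZ, rfl⟩ := h
  exact ⟨Opposite.op Z, p.op, i.op, hZ, rfl⟩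

lemma FactorsThrough.unop {P : ObjectProperty B} {X Y : Bᵒᵖ} {f : X ⟶ Y}
    (h : FactorsThrough P.op f) : FactorsThrough P f.unop := by
  obtain ⟨Z, i, p, hZ, rfl⟩ := h
  exact ⟨Z.unop, p.unop, i.unop, hZ, rfl⟩

variable [Preadditive B] [HasBinaryBiproducts B]

lemma FactorsThrough.add {P : ObjectProperty B} (hP : IsAdditiveSubcategory P) {X Y : B}
    {f g : X ⟶ Y} (hf : FactorsThrough P f) (hg : FactorsThrough P g) :
    FactorsThrough P (f + g) := by
  obtain ⟨Z, i, p, hZ, rfl⟩ := hf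
  obtain ⟨Z', i', p', hZ', rfl⟩ := hg
  exact ⟨Z ⊞ Z', biprod.lift i i', biprod.desc p p', hP.biprod hZ hZ', biprod.lift_desc ..⟩

lemma IsAdditiveSubcategory.op {P : ObjectProperty B} (h : IsAdditiveSubcategory P) :
    IsAdditiveSubcategory P.op where
  zero _ hZ := h.zero hZ.unop
  iso _ _ e hX := h.iso e.symm.unop hX
  biprod X Y hX hY := h.iso (opBiprodIso X Y).symm (h.biprod hX hY)

lemma ClosedUnderSummands.op {P : ObjectProperty B} (h : ClosedUnderSummands P)
    (h' : IsAdditiveSubcategory P) : ClosedUnderSummands P.op :=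
  fun X Y hXY => h (h'.iso (opBiprodIso X Y) hXY)

end Subcategories

namespace ExtriangulatedStructure

variable {B : Type u} [Category.{v} B] [Preadditive B] [HasZeroObject B] [HasBinaryBiproducts B]
  {𝓔 : ExtriangulatedStructure.{w} B}

lemma IsConflation.op {A M C : B} {x : A ⟶ M} {y : M ⟶ C} (h : 𝓔.IsConflation x y) :
    𝓔.op.IsConflation y.op x.op := by
  obtain ⟨δ, hδ⟩ := h
  exact ⟨δ, (SeqClass.op_eq_mk_iff _ _ _).2 hδ⟩

lemma IsConflation.unop {A M C : Bᵒᵖ} {x : A ⟶ M} {y : M ⟶ C} (h : 𝓔.op.IsConflation x y) :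
    𝓔.IsConflation y.unop x.unop := by
  obtain ⟨δ, hδ⟩ := h
  exact ⟨δ, (SeqClass.op_eq_mk_iff _ _ _).1 hδ⟩

lemma cone_op_iff {P Q : ObjectProperty B} {X : Bᵒᵖ} :
    𝓔.op.cone P.op Q.op X ↔ 𝓔.cocone Q P X.unop := by
  constructor
  · rintro ⟨P', Q', x, y, hP, hQ, h⟩
    exact ⟨Q'.unop, P'.unop, y.unop, x.unop, hQ, hP, h.unop⟩
  · rintro ⟨Q', P', x, y, hQ, hP, h⟩
    exact ⟨Opposite.op P', Opposite.op Q', y.op, x.op, hP, hQ, h.op⟩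

lemma cocone_op_iff {P Q : ObjectProperty B} {X : Bᵒᵖ} :
    𝓔.op.cocone P.op Q.op X ↔ 𝓔.cone Q P X.unop := by
  constructor
  · rintro ⟨P', Q', x, y, hP, hQ, h⟩
    exact ⟨Q'.unop, P'.unop, y.unop, x.unop, hQ, hP, h.unop⟩
  · rintro ⟨Q', P', x, y, hQ, hP, h⟩
    exact ⟨Opposite.op P', Opposite.op Q', y.op, x.op, hP, hQ, h.op⟩

lemma IsCotorsionPair.op {U V : ObjectProperty B} (h : 𝓔.IsCotorsionPair U V) :
    𝓔.op.IsCotorsionPair V.op U.op where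
  additive_left := h.additive_right.op
  summands_left := h.summands_right.op h.additive_right
  additive_right := h.additive_left.op
  summands_right := h.summands_left.op h.additive_left
  ext_vanish _ _ hC hA δ := h.ext_vanish hA hC δ
  resolution X := cone_op_iff.2 (h.coresolution X.unop)
  coresolution X := cocone_op_iff.2 (h.resolution X.unop)

/-- In a cotorsion pair `(U, V)`, the class `U` is the left orthogonal of `V`. -/
lemma IsCotorsionPair.left_of_ext_eq_zero {U V : ObjectProperty B} (h : 𝓔.IsCotorsionPair U V)
    {X : B} (hX : ∀ ⦃Q : B⦄, V Q → ∀ ε : Extension 𝓔.E X Q, ε = 0) : U X := by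
  obtain ⟨Q, M, x, y, hQ, hM, ε, hε⟩ := h.resolution X
  rw [hX hQ ε, 𝓔.real_zero, SeqClass.mk_eq_mk_iff] at hε
  obtain ⟨b, -, -⟩ := hε
  exact (h.summands_left (h.additive_left.iso b.symm hM)).2

/-- The left class of a cotorsion pair is closed under extensions. -/
lemma IsCotorsionPair.left_of_isConflation {U V : ObjectProperty B} (h : 𝓔.IsCotorsionPair U V)
    {A M C : B} {x : A ⟶ M} {y : M ⟶ C} (hxy : 𝓔.IsConflation x y) (hA : U A) (hC : U C) :
    U M := by
  obtain ⟨δ, hδ⟩ := hxy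
  exact h.left_of_ext_eq_zero fun Q hQ ε =>
    eq_zero_of_pull_fst_eq_zero hδ (h.ext_vanish hC hQ) ε (h.ext_vanish hA hQ _)

/-- The composite of two conflations whose third terms lie in the left class of a cotorsion pair
is again of this form. -/
lemma IsCotorsionPair.exists_isConflation_comp {U V : ObjectProperty B}
    (h : 𝓔.IsCotorsionPair U V) {A M N D F : B} {f : A ⟶ M} {f' : M ⟶ D} {g : M ⟶ N} {g' : N ⟶ F}
    (hf : 𝓔.IsConflation f f') (hg : 𝓔.IsConflation g g') (hD : U D) (hF : U F) :
    ∃ (X : B) (p : N ⟶ X), U X ∧ 𝓔.IsConflation (f ≫ g) p := by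
  obtain ⟨δ, hδ⟩ := hf
  obtain ⟨δ', hδ'⟩ := hg
  obtain ⟨X, k, p, d, e, δ'', rfl, -, -, hp, hde, -⟩ := 𝓔.et4 _ _ _ _ _ _ hδ hδ'
  exact ⟨X, p, h.left_of_isConflation ⟨_, hde⟩ hD hF, δ'', hp⟩

namespace TwinCotorsionPair

variable (τ : 𝓔.TwinCotorsionPair)

/-- The twin cotorsion pair `((𝒱, 𝒰), (𝒯, 𝒮))` on the opposite category. -/
noncomputable def op : 𝓔.op.TwinCotorsionPair where
  S := τ.V.op
  T := τ.U.op
  U := τ.T.op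
  V := τ.S.op
  cotorsion_ST := τ.cotorsion_UV.op
  cotorsion_UV := τ.cotorsion_ST.op
  ext_vanish _ _ hC hA δ := τ.ext_vanish hA hC δ

lemma op_W : τ.op.W = τ.W.op := by
  ext X
  exact and_comm

lemma op_plus_iff {X : Bᵒᵖ} : τ.op.plus X ↔ τ.minus X.unop := by
  rw [plus, op_W]
  exact cone_op_iff

lemma op_minus_iff {X : Bᵒᵖ} : τ.op.minus X ↔ τ.plus X.unop := by
  rw [minus, op_W]
  exact cocone_op_iff

lemma op_heartObj_iff {X : Bᵒᵖ} : τ.op.heartObj X ↔ τ.heartObj X.unop := by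
  rw [heartObj, heartObj, op_plus_iff, op_minus_iff, and_comm]

/-! ### The classes `B⁻` and `B⁺` -/

variable {τ}

/-- The class `B⁻` consists of the objects `X` such that every class in `𝔼(T, V)`, with `T ∈ 𝒯`
and `V ∈ 𝒱`, vanishes when pulled back to `X`. -/
lemma minus_iff {X : B} : τ.minus X ↔ ∀ ⦃T V : B⦄, τ.T T → τ.V V → ∀ (f : X ⟶ T)
    (ε : Extension 𝓔.E T V), pull 𝓔.E f ε = 0 := by
  constructor
  · rintro ⟨W, S, x, y, hW, hS, δ, hδ⟩ T V hT hV f ε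
    obtain ⟨k, rfl⟩ := exists_extension hδ f (τ.cotorsion_ST.ext_vanish hS hT _)
    rw [pull_comp, τ.cotorsion_UV.ext_vanish hW.2 hV (pull 𝓔.E k ε), pull_zero_ext]
  · intro h
    obtain ⟨T, S, x, y, hT, hS, δ, hδ⟩ := τ.cotorsion_ST.coresolution X
    refine ⟨T, S, x, y, ⟨hT, τ.cotorsion_UV.left_of_ext_eq_zero fun V hV ε => ?_⟩, hS, δ, hδ⟩
    exact eq_zero_of_pull_fst_eq_zero hδ (τ.ext_vanish hS hV) ε (h hT hV x ε)

/-- `B⁻` is closed under the kernels of deflations `Z ⟶ S` with `S ∈ 𝒮`. -/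
lemma minus_of_isConflation_left {X Z S : B} {x : X ⟶ Z} {s : Z ⟶ S} (h : 𝓔.IsConflation x s)
    (hZ : τ.minus Z) (hS : τ.S S) : τ.minus X := by
  obtain ⟨δ, hδ⟩ := h
  rw [minus_iff] at hZ ⊢
  intro T V hT hV f ε
  obtain ⟨k, rfl⟩ := exists_extension hδ f (τ.cotorsion_ST.ext_vanish hS hT _)
  rw [pull_comp, hZ hT hV k, pull_zero_ext]

/-- `B⁻` is closed under extensions by objects of `𝒮`. -/
lemma minus_of_isConflation_middle {X Z S : B} {x : X ⟶ Z} {s : Z ⟶ S}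
    (h : 𝓔.IsConflation x s) (hX : τ.minus X) (hS : τ.S S) : τ.minus Z := by
  obtain ⟨δ, hδ⟩ := h
  rw [minus_iff] at hX ⊢
  intro T V hT hV f ε
  refine eq_zero_of_pull_fst_eq_zero hδ (τ.ext_vanish hS hV) _ ?_
  rw [← pull_comp, hX hT hV]

lemma minus_zero {X : B} (hX : IsZero X) : τ.minus X :=
  minus_iff.2 fun _ _ _ _ f _ => by rw [hX.eq_zero_of_src f, pull_zero]

lemma minus_biprod {X Y : B} (hX : τ.minus X) (hY : τ.minus Y) : τ.minus (X ⊞ Y) := by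
  rw [minus_iff] at hX hY ⊢
  intro T V hT hV f ε
  have : f = biprod.fst ≫ biprod.inl ≫ f + biprod.snd ≫ biprod.inr ≫ f := by ext <;> simp
  rw [this, pull_add, pull_comp, pull_comp _ biprod.snd, hX hT hV, hY hT hV, pull_zero_ext,
    pull_zero_ext, add_zero]

lemma minus_of_W {X : B} (hX : τ.W X) : τ.minus X :=
  minus_iff.2 fun _ _ _ hV _ _ => τ.cotorsion_UV.ext_vanish hX.2 hV _

lemma minus_of_iso {X Y : B} (e : X ≅ Y) (hX : τ.minus X) : τ.minus Y := by
  rw [minus_iff] at hX ⊢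
  intro T V hT hV f ε
  rw [← e.inv_hom_id_assoc f, pull_comp, hX hT hV, pull_zero_ext]

variable (τ) in
lemma heartObj_zero {X : B} (hX : IsZero X) : τ.heartObj X :=
  ⟨(op_minus_iff τ (X := Opposite.op X)).1 (minus_zero hX.op), minus_zero hX⟩

lemma heartObj_biprod {X Y : B} (hX : τ.heartObj X) (hY : τ.heartObj Y) :
    τ.heartObj (X ⊞ Y) := by
  refine ⟨(op_minus_iff τ (X := Opposite.op (X ⊞ Y))).1 ?_, minus_biprod hX.2 hY.2⟩
  exact minus_of_iso (opBiprodIso (Opposite.op X) (Opposite.op Y)).op.symm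
    (minus_biprod ((op_minus_iff τ).2 hX.1) ((op_minus_iff τ).2 hY.1))

/-- If `X ⟶ Z` is an inflation with cokernel in `𝒮`, then it is an epimorphism modulo `𝒲` with
respect to the morphisms to objects of `B⁺`. -/
lemma factorsThrough_of_comp {X Z S Y : B} {x : X ⟶ Z} {s : Z ⟶ S} (h : 𝓔.IsConflation x s)
    (hS : τ.S S) (hY : τ.plus Y) {g : Z ⟶ Y} (hg : FactorsThrough τ.W (x ≫ g)) :
    FactorsThrough τ.W g := by
  obtain ⟨δ, hδ⟩ := h
  obtain ⟨W, i, j, hW, hij⟩ := hg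
  obtain ⟨V, W', v, q, hV, hW', ν, hν⟩ := hY
  obtain ⟨k, hk⟩ := exists_extension hδ i (τ.cotorsion_ST.ext_vanish hS hW.1 _)
  obtain ⟨m, hm⟩ := exists_factor_snd hδ (g - k ≫ j) (by
    rw [Preadditive.comp_sub, reassoc_of% hk, hij, sub_self])
  obtain ⟨m', rfl⟩ := exists_lift hν m (τ.ext_vanish hS hV _)
  rw [show g = k ≫ j + s ≫ m' ≫ q by rw [hm]; abel]
  exact .add τ.isAdditiveSubcategory_W ⟨W, k, j, hW, rfl⟩ ⟨W', s ≫ m', q, hW', by simp⟩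

/-- Every object `C` has an approximation `C ⟶ D` in `B⁺`: it is an inflation with cokernel in
`𝒮`, and every morphism from `C` to an object of `B⁺` extends to `D`. -/
lemma exists_plus_approximation (C : B) :
    ∃ (D S : B) (d : C ⟶ D) (s : D ⟶ S), τ.plus D ∧ τ.S S ∧ 𝓔.IsConflation d s ∧
      ∀ ⦃Y : B⦄, τ.plus Y → ∀ g : C ⟶ Y, ∃ h : D ⟶ Y, d ≫ h = g := by
  obtain ⟨V, U, v, p, hV, hU, η, hη⟩ := τ.cotorsion_UV.resolution C
  obtain ⟨T, S, t, t', hT, hS, θ, hθ⟩ := τ.cotorsion_ST.coresolution U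
  have hTU : τ.U T := τ.cotorsion_UV.left_of_ext_eq_zero fun Q hQ ε =>
    eq_zero_of_pull_fst_eq_zero hθ (τ.ext_vanish hS hQ) ε (τ.cotorsion_UV.ext_vanish hU hQ _)
  obtain ⟨D, _, h', d, s, δ, rfl, -, -, hD, hds, -⟩ := 𝓔.et4 _ _ _ _ _ _ hη hθ
  refine ⟨D, S, d, s, ⟨V, T, _, h', hV, ⟨hT, hTU⟩, δ, hD⟩, hS, ⟨_, hds⟩, ?_⟩
  rintro Y ⟨V', W, v', q, hV', hW, ν, hν⟩ g
  refine exists_extension hds g ?_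
  -- The obstruction is the image of `θ` under `U ⟶ C ⟶ Y`, which factors through `W ∈ 𝒯`.
  obtain ⟨k, hk⟩ := exists_lift hν (p ≫ g) (τ.cotorsion_UV.ext_vanish hU hV' _)
  rw [← push_comp, ← hk, push_comp, τ.cotorsion_ST.ext_vanish hS hW.1 (push 𝓔.E k θ),
    push_zero_ext]

/-! ### Cokernels and kernels modulo `𝒲` -/

/-- Every morphism `f` between objects of `ℋ` has a cokernel `c` modulo `𝒲`, and every morphism `b`
from an object of `ℋ` to the target of `c` can be completed to a square, commutative modulo `𝒲`,
over `b` and `c`, whose side opposite to `c` is an epimorphism modulo `𝒲`. -/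
theorem exists_cokernel {A Z : B} (hA : τ.heartObj A) (hZ : τ.heartObj Z) (f : A ⟶ Z) :
    ∃ (C : B) (c : Z ⟶ C), τ.heartObj C ∧ FactorsThrough τ.W (f ≫ c) ∧
      (∀ ⦃Y : B⦄, τ.heartObj Y → ∀ g : Z ⟶ Y, FactorsThrough τ.W (f ≫ g) → ∃ h, c ≫ h = g) ∧
      (∀ ⦃Y : B⦄, τ.heartObj Y → ∀ h : C ⟶ Y, FactorsThrough τ.W (c ≫ h) →
        FactorsThrough τ.W h) ∧
      ∀ ⦃D : B⦄, τ.heartObj D → ∀ b : D ⟶ C, ∃ (X : B) (x : X ⟶ D) (x' : X ⟶ Z),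
        τ.heartObj X ∧ FactorsThrough τ.W (x ≫ b - x' ≫ c) ∧
        ∀ ⦃Y : B⦄, τ.heartObj Y → ∀ g : D ⟶ Y, FactorsThrough τ.W (x ≫ g) →
          FactorsThrough τ.W g := by
  obtain ⟨W, S, i, j, hW, hS, δ, hδ⟩ := hA.2
  -- The pushout `C₀` of `A ⟶ W` along `f` lies in `B⁻`; its approximation `C` is the cokernel.
  obtain ⟨C₀, c₀, s₀, hC₀⟩ := 𝓔.exists_real (push 𝓔.E f δ)
  obtain ⟨C, S', d, s', hCp, hS', hds, hext⟩ := exists_plus_approximation (τ := τ) C₀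
  obtain ⟨S'', s, hS'', hs⟩ := τ.cotorsion_ST.exists_isConflation_comp ⟨_, hC₀⟩ hds hS hS'
  have hCm : τ.minus C := minus_of_isConflation_middle hs hZ.2 hS''
  refine ⟨C, c₀ ≫ d, ⟨hCp, hCm⟩, ?_, ?_, ?_, ?_⟩
  · obtain ⟨k, hk, -⟩ := 𝓔.real_lift _ _ _ _ _ _ hδ hC₀ f (𝟙 S) (pull_id _ _).symm
    exact ⟨W, i, k ≫ d, hW, by rw [reassoc_of% hk]⟩
  · rintro Y hY g ⟨W', i', p', hW', hg⟩
    obtain ⟨h, hh⟩ := exists_extension hC₀ g (by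
      rw [← push_comp, ← hg, push_comp, τ.cotorsion_ST.ext_vanish hS hW'.1 (push 𝓔.E i' δ),
        push_zero_ext])
    obtain ⟨h', rfl⟩ := hext hY.1 h
    exact ⟨h', by rw [Category.assoc, hh]⟩
  · exact fun Y hY h hh => factorsThrough_of_comp hs hS'' hY.1 hh
  · intro D hD b
    -- Adding `W' ∈ 𝒲` to `D` turns the composite `D ⟶ C ⟶ S''` into a deflation `D ⊞ W' ⟶ S''`.
    obtain ⟨V, W', v, q, hV, hW', ν, hν⟩ := id hCp
    obtain ⟨σ, hσ⟩ := hs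
    obtain ⟨L, l, -, -, -, σ', rfl, -, -, hl, -⟩ := 𝓔.et4_op _ _ _ _ _ _ hσ hν
    obtain ⟨K, k, hk⟩ := 𝓔.isConflation_biprod_desc ⟨σ', hl⟩ (b ≫ s)
    have hKm : τ.minus K :=
      minus_of_isConflation_left hk (minus_biprod hD.2 (minus_of_W hW')) hS''
    obtain ⟨x', hx'⟩ := exists_factor_fst hσ (k ≫ biprod.desc b q) (by
      obtain ⟨κ, hκ⟩ := hk
      rw [← comp_eq_zero hκ, Category.assoc]
      congr 1
      ext <;> simp)
    obtain ⟨X, S₁, m, m', hXp, hS₁, hm, hmext⟩ := exists_plus_approximation (τ := τ) K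
    obtain ⟨x₁, hx₁⟩ := hmext hD.1 (k ≫ biprod.fst)
    obtain ⟨x₂, hx₂⟩ := hmext hZ.1 x'
    have hX : τ.heartObj X := ⟨hXp, minus_of_isConflation_middle hm hKm hS₁⟩
    refine ⟨X, x₁, x₂, hX, ?_, ?_⟩
    · refine factorsThrough_of_comp hm hS₁ hCp ⟨W', k ≫ biprod.snd, -q, hW', ?_⟩
      have : k ≫ biprod.desc b q = k ≫ biprod.fst ≫ b + k ≫ biprod.snd ≫ q := by
        rw [← Preadditive.comp_add]
        congr 1
        ext <;> simp
      rw [Preadditive.comp_sub, reassoc_of% hx₁, reassoc_of% hx₂, hx', this]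
      simp
    · rintro Y hY g ⟨W₁, i₁, p₁, hW₁, hg⟩
      have h₁ : FactorsThrough τ.W (k ≫ biprod.fst ≫ g) :=
        ⟨W₁, m ≫ i₁, p₁, hW₁, by rw [Category.assoc, hg, reassoc_of% hx₁]⟩
      obtain ⟨W₂, i₂, p₂, hW₂, hg₂⟩ := factorsThrough_of_comp hk hS'' hY.1 h₁
      exact ⟨W₂, biprod.inl ≫ i₂, p₂, hW₂, by simp [hg₂]⟩

/-- The dual of `exists_cokernel`. -/
theorem exists_kernel {Z A : B} (hZ : τ.heartObj Z) (hA : τ.heartObj A) (f : Z ⟶ A) :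
    ∃ (K : B) (k : K ⟶ Z), τ.heartObj K ∧ FactorsThrough τ.W (k ≫ f) ∧
      (∀ ⦃Y : B⦄, τ.heartObj Y → ∀ g : Y ⟶ Z, FactorsThrough τ.W (g ≫ f) → ∃ h, h ≫ k = g) ∧
      (∀ ⦃Y : B⦄, τ.heartObj Y → ∀ h : Y ⟶ K, FactorsThrough τ.W (h ≫ k) →
        FactorsThrough τ.W h) ∧
      ∀ ⦃D : B⦄, τ.heartObj D → ∀ b : K ⟶ D, ∃ (X : B) (x : D ⟶ X) (x' : Z ⟶ X),
        τ.heartObj X ∧ FactorsThrough τ.W (b ≫ x - k ≫ x') ∧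
        ∀ ⦃Y : B⦄, τ.heartObj Y → ∀ g : Y ⟶ D, FactorsThrough τ.W (g ≫ x) →
          FactorsThrough τ.W g := by
  obtain ⟨C, c, hC, h₁, h₂, h₃, h₄⟩ := exists_cokernel (τ := τ.op)
    (op_heartObj_iff τ (X := Opposite.op A) |>.2 hA)
    (op_heartObj_iff τ (X := Opposite.op Z) |>.2 hZ) f.op
  rw [op_W] at h₁ h₂ h₃ h₄
  refine ⟨C.unop, c.unop, (op_heartObj_iff τ).1 hC, h₁.unop, ?_, ?_, ?_⟩
  · intro Y hY g hg
    obtain ⟨h, hh⟩ := h₂ ((op_heartObj_iff τ (X := Opposite.op Y)).2 hY) g.op hg.op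
    exact ⟨h.unop, Quiver.Hom.op_inj hh⟩
  · intro Y hY h hh
    exact (h₃ ((op_heartObj_iff τ (X := Opposite.op Y)).2 hY) h.op hh.op).unop
  · intro D hD b
    obtain ⟨X, x, x', hX, h₅, h₆⟩ := h₄ ((op_heartObj_iff τ (X := Opposite.op D)).2 hD) b.op
    refine ⟨X.unop, x.unop, x'.unop, (op_heartObj_iff τ).1 hX, h₅.unop, ?_⟩
    intro Y hY g hg
    exact (h₆ ((op_heartObj_iff τ (X := Opposite.op Y)).2 hY) g.op hg.op).unop

end TwinCotorsionPair
end ExtriangulatedStructure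

/-! ### A criterion for semi-abelian categories -/

/-- A criterion for semi-abelianness: cokernels exist and are such that every morphism to a
cokernel can be completed to a commutative square whose side opposite to the cokernel is an
epimorphism, and dually. In a pull-back square the latter epimorphism factors through the
side opposite to the cokernel. -/
lemma isSemiabelian_of_exists {A : Type u} [Category.{v} A] [Preadditive A]
    (h₀ : HasZeroObject A) (h₁ : HasBinaryBiproducts A)
    (hc : ∀ ⦃X Y : A⦄ (f : X ⟶ Y), ∃ (C : A) (c : Y ⟶ C) (w : f ≫ c = 0),
      Nonempty (IsColimit (CokernelCofork.ofπ c w)) ∧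
      ∀ ⦃D : A⦄ (b : D ⟶ C), ∃ (P : A) (x : P ⟶ D) (x' : P ⟶ Y), x ≫ b = x' ≫ c ∧ Epi x)
    (hk : ∀ ⦃X Y : A⦄ (f : X ⟶ Y), ∃ (K : A) (k : K ⟶ X) (w : k ≫ f = 0),
      Nonempty (IsLimit (KernelFork.ofι k w)) ∧
      ∀ ⦃D : A⦄ (b : K ⟶ D), ∃ (P : A) (x : D ⟶ P) (x' : X ⟶ P), b ≫ x = k ≫ x' ∧ Mono x) :
    IsSemiabelian A where
  hasZeroObject := h₀
  hasBinaryBiproducts := h₁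
  hasKernels := ⟨fun f => by
    obtain ⟨K, k, w, ⟨hl⟩, -⟩ := hk f
    exact ⟨⟨_, hl⟩⟩⟩
  hasCokernels := ⟨fun f => by
    obtain ⟨C, c, w, ⟨hl⟩, -⟩ := hc f
    exact ⟨⟨_, hl⟩⟩⟩
  left X Y Z D a b c d sq hd := by
    obtain ⟨⟨W, g, w, hl⟩⟩ := hd
    obtain ⟨C, c', w', ⟨hl'⟩, h⟩ := hc g
    let e : D ≅ C := hl.coconePointUniqueUpToIso hl'
    have he : d ≫ e.hom = c' := hl.comp_coconePointUniqueUpToIso_hom hl' WalkingParallelPair.one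
    obtain ⟨P, x, x', hx, hepi⟩ := h (c ≫ e.hom)
    have hx' : x ≫ c = x' ≫ d := by
      rw [← cancel_mono e.hom, Category.assoc, hx, Category.assoc, he]
    have := sq.lift_fst x x' hx'
    exact epi_of_epi_fac this
  right X Y Z D a b c d sq hd := by
    obtain ⟨⟨W, g, w, hl⟩⟩ := hd
    obtain ⟨K, k', w', ⟨hl'⟩, h⟩ := hk g
    let e : K ≅ D := hl'.conePointUniqueUpToIso hl
    have he : e.hom ≫ d = k' := hl'.conePointUniqueUpToIso_hom_comp hl WalkingParallelPair.zero
    obtain ⟨P, x, x', hx, hmono⟩ := h (e.hom ≫ c)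
    have hx' : c ≫ x = d ≫ x' := by
      rw [← cancel_epi e.hom, ← Category.assoc, hx, ← Category.assoc, he]
    have := sq.inl_desc x x' hx'
    exact mono_of_mono_fac this

/-! ### The heart -/

namespace ExtriangulatedStructure.TwinCotorsionPair

variable {B : Type u} [Category.{v} B] [Preadditive B] [HasZeroObject B] [HasBinaryBiproducts B]
  {𝓔 : ExtriangulatedStructure.{w} B} {τ : 𝓔.TwinCotorsionPair}

/-- The morphism of the heart represented by a morphism of `B`. -/
def heartMap {X Y : τ.Heart} (f : X.obj.as ⟶ Y.obj.as) : X ⟶ Y :=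
  ObjectProperty.homMk ((CategoryTheory.Quotient.functor (idealRel τ.W)).map f)

lemma heartMap_surjective {X Y : τ.Heart} (φ : X ⟶ Y) : ∃ f, heartMap f = φ := by
  obtain ⟨f, hf⟩ := (CategoryTheory.Quotient.functor (idealRel τ.W)).map_surjective
    (X := X.obj.as) (Y := Y.obj.as) φ.hom
  exact ⟨f, ObjectProperty.hom_ext _ hf⟩

lemma heartMap_comp {X Y Z : τ.Heart} (f : X.obj.as ⟶ Y.obj.as) (g : Y.obj.as ⟶ Z.obj.as) :
    heartMap (f ≫ g) = (heartMap f : X ⟶ Y) ≫ (heartMap g : Y ⟶ Z) :=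
  ObjectProperty.hom_ext _ ((CategoryTheory.Quotient.functor (idealRel τ.W)).map_comp f g)

lemma heartMap_id (X : τ.Heart) : heartMap (𝟙 X.obj.as) = 𝟙 X :=
  ObjectProperty.hom_ext _ ((CategoryTheory.Quotient.functor (idealRel τ.W)).map_id _)

lemma heartMap_add {X Y : τ.Heart} (f g : X.obj.as ⟶ Y.obj.as) :
    (heartMap (f + g) : X ⟶ Y) = heartMap f + heartMap g :=
  rfl

lemma heartMap_zero (X Y : τ.Heart) : (heartMap 0 : X ⟶ Y) = 0 := by
  have h := heartMap_add (X := X) (Y := Y) 0 0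
  rwa [add_zero, left_eq_add] at h

lemma heartMap_eq_iff {X Y : τ.Heart} (f g : X.obj.as ⟶ Y.obj.as) :
    (heartMap f : X ⟶ Y) = heartMap g ↔ FactorsThrough τ.W (f - g) := by
  have := idealRel_congruence τ.isAdditiveSubcategory_W
  rw [← show _ ↔ FactorsThrough τ.W (f - g) from
    CategoryTheory.Quotient.functor_map_eq_iff (idealRel τ.W) f g]
  exact ⟨fun h => congr(($h).hom), fun h => ObjectProperty.hom_ext _ h⟩

lemma heartMap_eq_zero_iff {X Y : τ.Heart} (f : X.obj.as ⟶ Y.obj.as) :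
    (heartMap f : X ⟶ Y) = 0 ↔ FactorsThrough τ.W f := by
  rw [← heartMap_zero, heartMap_eq_iff, sub_zero]

lemma heartMap_comp_eq_zero_iff {X Y Z : τ.Heart} (f : X.obj.as ⟶ Y.obj.as)
    (g : Y.obj.as ⟶ Z.obj.as) :
    (heartMap f : X ⟶ Y) ≫ (heartMap g : Y ⟶ Z) = 0 ↔ FactorsThrough τ.W (f ≫ g) := by
  rw [← heartMap_comp, heartMap_eq_zero_iff]

lemma heartMap_comp_eq_comp_iff {X Y Y' Z : τ.Heart} (f : X.obj.as ⟶ Y.obj.as)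
    (g : Y.obj.as ⟶ Z.obj.as) (f' : X.obj.as ⟶ Y'.obj.as) (g' : Y'.obj.as ⟶ Z.obj.as) :
    (heartMap f : X ⟶ Y) ≫ (heartMap g : Y ⟶ Z) = (heartMap f' : X ⟶ Y') ≫ heartMap g' ↔
      FactorsThrough τ.W (f ≫ g - f' ≫ g') := by
  rw [← heartMap_comp, ← heartMap_comp, heartMap_eq_iff]

variable (τ) in
/-- The object of the heart given by an object of `ℋ`. -/
def heartMk (X : B) (hX : τ.heartObj X) : τ.Heart :=
  ⟨⟨X⟩, hX⟩

variable (τ)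

lemma hasZeroObject_heart : HasZeroObject τ.Heart := by
  obtain ⟨Z, hZ⟩ := HasZeroObject.zero (C := B)
  refine ⟨τ.heartMk Z (heartObj_zero τ hZ), ?_⟩
  rw [IsZero.iff_id_eq_zero, ← heartMap_id, ← heartMap_zero]
  exact congrArg heartMap (hZ.eq_of_src _ _)

lemma hasBinaryBiproducts_heart : HasBinaryBiproducts τ.Heart where
  has_binary_biproduct X Y := by
    let P := τ.heartMk (X.obj.as ⊞ Y.obj.as) (heartObj_biprod X.property Y.property)
    have comp_eq : ∀ {X Y Z : τ.Heart} {f : X.obj.as ⟶ Y.obj.as} {g : Y.obj.as ⟶ Z.obj.as}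
        {h : X.obj.as ⟶ Z.obj.as}, f ≫ g = h →
        (heartMap f : X ⟶ Y) ≫ (heartMap g : Y ⟶ Z) = heartMap h := by
      rintro X Y Z f g _ rfl
      exact (heartMap_comp f g).symm
    refine HasBinaryBiproduct.mk
      { bicone :=
          { pt := P
            fst := heartMap (X := P) (Y := X) biprod.fst
            snd := heartMap (X := P) (Y := Y) biprod.snd
            inl := heartMap (X := X) (Y := P) biprod.inl
            inr := heartMap (X := Y) (Y := P) biprod.inr
            inl_fst := (comp_eq biprod.inl_fst).trans (heartMap_id X)
            inl_snd := (comp_eq biprod.inl_snd).trans (heartMap_zero X Y)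
            inr_fst := (comp_eq biprod.inr_fst).trans (heartMap_zero Y X)
            inr_snd := (comp_eq biprod.inr_snd).trans (heartMap_id Y) }
        isBilimit := isBinaryBilimitOfTotal _ ?_ }
    refine (congrArg₂ (· + ·) (comp_eq (X := P) (Y := X) (Z := P) rfl)
      (comp_eq (X := P) (Y := Y) (Z := P) rfl)).trans ?_
    exact (heartMap_add (X := P) (Y := P) _ _).symm.trans
      ((congrArg heartMap biprod.total).trans (heartMap_id P))

lemma exists_cokernel_heart {X Y : τ.Heart} (φ : X ⟶ Y) :
    ∃ (C : τ.Heart) (c : Y ⟶ C) (w : φ ≫ c = 0),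
      Nonempty (IsColimit (CokernelCofork.ofπ c w)) ∧
      ∀ ⦃D : τ.Heart⦄ (b : D ⟶ C), ∃ (P : τ.Heart) (x : P ⟶ D) (x' : P ⟶ Y),
        x ≫ b = x' ≫ c ∧ Epi x := by
  obtain ⟨f, rfl⟩ := heartMap_surjective φ
  obtain ⟨C, c, hC, hfc, hdesc, huniq, hsq⟩ := exists_cokernel X.property Y.property f
  let C' := τ.heartMk C hC
  have w : heartMap f ≫ (heartMap c : Y ⟶ C') = 0 :=
    (heartMap_comp_eq_zero_iff (Z := C') f c).2 hfc
  have : Epi (heartMap c : Y ⟶ C') := Preadditive.epi_of_cancel_zero _ fun {Z} ψ hψ => by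
    obtain ⟨h, rfl⟩ := heartMap_surjective ψ
    exact (heartMap_eq_zero_iff _).2
      (huniq Z.property h ((heartMap_comp_eq_zero_iff (Y := C') c h).1 hψ))
  refine ⟨C', heartMap c, w, ⟨CokernelCofork.IsColimit.ofπ' _ w fun {Z} ψ hψ =>
    Classical.choice ?_⟩, fun D β => ?_⟩
  · obtain ⟨g, rfl⟩ := heartMap_surjective ψ
    obtain ⟨h, rfl⟩ := hdesc Z.property g ((heartMap_comp_eq_zero_iff f g).1 hψ)
    exact ⟨heartMap (X := C') h, (heartMap_comp (Y := C') c h).symm⟩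
  · obtain ⟨b, rfl⟩ := heartMap_surjective β
    obtain ⟨P, x, x', hP, hx, hxepi⟩ := hsq D.property b
    let P' := τ.heartMk P hP
    refine ⟨P', heartMap x, heartMap x',
      (heartMap_comp_eq_comp_iff (X := P') (Z := C') x b x' c).2 hx,
      Preadditive.epi_of_cancel_zero _ fun {Z} ψ hψ => ?_⟩
    obtain ⟨g, rfl⟩ := heartMap_surjective ψ
    exact (heartMap_eq_zero_iff _).2
      (hxepi Z.property g ((heartMap_comp_eq_zero_iff (X := P') x g).1 hψ))

lemma exists_kernel_heart {X Y : τ.Heart} (φ : X ⟶ Y) :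
    ∃ (K : τ.Heart) (k : K ⟶ X) (w : k ≫ φ = 0),
      Nonempty (IsLimit (KernelFork.ofι k w)) ∧
      ∀ ⦃D : τ.Heart⦄ (b : K ⟶ D), ∃ (P : τ.Heart) (x : D ⟶ P) (x' : X ⟶ P),
        b ≫ x = k ≫ x' ∧ Mono x := by
  obtain ⟨f, rfl⟩ := heartMap_surjective φ
  obtain ⟨K, k, hK, hkf, hlift, huniq, hsq⟩ := exists_kernel X.property Y.property f
  let K' := τ.heartMk K hK
  have w : (heartMap k : K' ⟶ X) ≫ heartMap f = 0 :=
    (heartMap_comp_eq_zero_iff (X := K') k f).2 hkf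
  have : Mono (heartMap k : K' ⟶ X) := Preadditive.mono_of_cancel_zero _ fun {Z} ψ hψ => by
    obtain ⟨h, rfl⟩ := heartMap_surjective ψ
    exact (heartMap_eq_zero_iff _).2
      (huniq Z.property h ((heartMap_comp_eq_zero_iff (Y := K') h k).1 hψ))
  refine ⟨K', heartMap k, w, ⟨KernelFork.IsLimit.ofι' _ w fun {Z} ψ hψ =>
    Classical.choice ?_⟩, fun D β => ?_⟩
  · obtain ⟨g, rfl⟩ := heartMap_surjective ψ
    obtain ⟨h, rfl⟩ := hlift Z.property g ((heartMap_comp_eq_zero_iff g f).1 hψ)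
    exact ⟨heartMap (Y := K') h, (heartMap_comp (Y := K') h k).symm⟩
  · obtain ⟨b, rfl⟩ := heartMap_surjective β
    obtain ⟨P, x, x', hP, hx, hxmono⟩ := hsq D.property b
    let P' := τ.heartMk P hP
    refine ⟨P', heartMap x, heartMap x',
      (heartMap_comp_eq_comp_iff (X := K') (Z := P') b x k x').2 hx,
      Preadditive.mono_of_cancel_zero _ fun {Z} ψ hψ => ?_⟩
    obtain ⟨g, rfl⟩ := heartMap_surjective ψ
    exact (heartMap_eq_zero_iff _).2
      (hxmono Z.property g ((heartMap_comp_eq_zero_iff (Z := P') g x).1 hψ))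

end ExtriangulatedStructure.TwinCotorsionPair

end Extri

theorem theoremC4p3 {B : Type u} [Category.{v} B] [Preadditive B] [HasZeroObject B]
    [HasBinaryBiproducts B] (𝓔 : Extri.ExtriangulatedStructure.{w} B)
    (τ : 𝓔.TwinCotorsionPair) : Extri.IsSemiabelian τ.Heart :=
  Extri.isSemiabelian_of_exists τ.hasZeroObject_heart τ.hasBinaryBiproducts_heart
    (fun _ _ => τ.exists_cokernel_heart) (fun _ _ => τ.exists_kernel_heart)
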